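/- Let $\mathscr A$ be a finite automaton with state set $Q$ over a finite alphabet $\Sigma=\{a_1,\dots,a_d\}$, with a transition relation (the transition function may be partial), a nonempty set of initial states and a nonempty set of final states. Assume that $\mathscr A$ is ergodic, i.e. for all states $s,t$ (possibly equal) there is a path of length $\ge 1$ from $s$ to $t$ in its diagram. Assume also that for each state all incoming edges carry one and the same label, and that attaching this label to the state is a bijection $Q\to\Sigma$, by which we identify $Q$ with $\Sigma$. Let $L$ be the set of words that label a path from some initial state to some final state. For $\mathbf i\in\mathbb N^d$ let $\gamma_{\mathbf i}$ be the number of words $w\in L$ in which each letter $a_k$ occurs exactly $i_k$ times. With $\|\mathbf x\|=\sum_k|x_k|$, define for an open cone $C\subset\mathbb R^d$ (an open set stable under multiplication by positive scalars) $$\tau_C=\limsup_{R\to\infty}\frac1R\log\sum_{\mathbf i\in C,\ R\le\|\mathbf i\|\le R+1}\gamma_{\mathbf i}\in[-\infty,+\infty]\qquad(\log 0=-\infty),$$ and define the indicatrice of growth by $\psi(\mathbf r)=\|\mathbf r\|\inf_{C\ni\mathbf r}\tau_C$ for $\mathbf r\ne 0$ (infimum over open cones $C$ containing $\mathbf r$),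 $\psi(0)=0$. Let $A=(a_{ij})_{i,j\in Q}$ be the adjacency matrix of $\mathscr A$, $\rho$ its Perron--Frobenius eigenvalue (its spectral radius), $\mathbf v\gg 0$ a vector with $A\mathbf v=\rho\mathbf v$, and $P=(p_{ij})$, $p_{ij}=\dfrac{a_{ij}v_j}{\rho v_i}$, the associated (Parry) stochastic matrix. Let $I$ be the rate function associated with the Markov chain determined by $P$, i.e. the large deviation rate function for the empirical frequencies of the letters, $$I(\mathbf r)=\sup_{\mathbf y\in\mathbb R^d}\bigl\{\langle\mathbf y,\mathbf r\rangle-\log\rho(\Pi(\mathbf y))\bigr\},\qquad \Pi(\mathbf y)=\bigl(p_{ij}e^{y_j}\bigr)_{i,j},$$ where $\rho(\Pi(\mathbf y))$ denotes the Perron--Frobenius eigenvalue of $\Pi(\mathbf y)$. Then for every $\mathbf r=(r_1,\dots,r_d)$ with $r_j\ge 0$ and $\sum_j r_j=1$, as an identity in $(-\infty,+\infty]$, $$I(\mathbf r)=\log\rho-\psi(\mathbf r),$$ and moreover $$I(\mathbf r)=\sup_{\mathbf u\gg 0}\ \sum_{j=1}^d r_j\log\frac{u_j}{(\mathbf uP)_j}.$$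 -/

import Mathlib

/-! ## Growth of coefficients in a direction -/

/-- The coefficient of the multivariate growth series of a language `L`: the number of words of `L`
in which every letter `a` occurs exactly `i a` times. -/
noncomputable def growthCoeff {α : Type*} [DecidableEq α] (L : Language α) (i : α → ℕ) : ℕ :=
  Set.ncard {w : List α | w ∈ L ∧ ∀ a, w.count a = i a}

/-- Open (not necessarily convex) linear cones of the Euclidean space with coordinates in `α`. -/
def IsOpenCone {α : Type*} (C : Set (α → ℝ)) : Prop :=
  IsOpen C ∧ ∀ x ∈ C, ∀ t : ℝ, 0 < t → t • x ∈ C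

/-- The sum of the coefficients `f i` over the multi-indices `i` that lie in `C` and satisfy
`R ≤ ‖i‖ ≤ R + 1` for the `l¹` norm. -/
noncomputable def shellSum {α : Type*} [Fintype α] (f : (α → ℕ) → ℕ) (C : Set (α → ℝ)) (R : ℝ) :
    ENNReal :=
  ∑' i : {i : α → ℕ // (fun a => (i a : ℝ)) ∈ C ∧ R ≤ ∑ a, (i a : ℝ) ∧ ∑ a, (i a : ℝ) ≤ R + 1},
    (f i.1 : ENNReal)

/-- The exponent `τ_C` of growth of the coefficients `f` in the cone `C`, with `log 0 = -∞`. -/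
noncomputable def coneExponent {α : Type*} [Fintype α] (f : (α → ℕ) → ℕ) (C : Set (α → ℝ)) :
    EReal :=
  Filter.limsup (fun R : ℝ => ((1 / R : ℝ) : EReal) * ENNReal.log (shellSum f C R)) Filter.atTop

open Classical in
/-- The indicatrice of growth `ψ` of the coefficients `f`. It takes values in the extended reals;
the value `-∞` does occur. -/
noncomputable def indicatrice {α : Type*} [Fintype α] (f : (α → ℕ) → ℕ) (r : α → ℝ) : EReal :=
  if r = 0 then 0
  else ((∑ a, |r a| : ℝ) : EReal) *
    ⨅ C : {C : Set (α → ℝ) // IsOpenCone C ∧ r ∈ C}, coneExponent f C.1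

/-! ## Automata -/

/-- The automaton is ergodic: any two states (distinct or not) are joined by a path with at least
one edge, that is, its diagram is strongly connected and has an edge. -/
def IsErgodicAutomaton {α σ : Type*} (M : NFA α σ) : Prop :=
  ∀ s t : σ, Relation.TransGen (fun p q => ∃ a, q ∈ M.step p a) s t

/-- The adjacency matrix of the diagram: the `(s, t)` entry is the number of edges from `s`
to `t`. -/
noncomputable def adjacencyMatrix {α σ : Type*} (M : NFA α σ) : Matrix σ σ ℝ :=
  Matrix.of fun s t => (Set.ncard {a : α | t ∈ M.step s a} : ℝ)

/-- The spectral radius of a real square matrix: the largest modulus of a complex eigenvalue. For an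
irreducible non-negative matrix it is the Perron-Frobenius eigenvalue. -/
noncomputable def perronRoot {σ : Type*} [Fintype σ] [DecidableEq σ] (A : Matrix σ σ ℝ) : ℝ :=
  (spectralRadius ℂ (A.map (fun x : ℝ => (x : ℂ)))).toReal

/-- The Parry matrix with entries `a_ij v_j / (ρ v_i)`, where `ρ` is the Perron-Frobenius eigenvalue
of `A`, and `v` is meant to be a strictly positive vector with `A v = ρ v`. -/
noncomputable def parryMatrix {σ : Type*} [Fintype σ] [DecidableEq σ] (A : Matrix σ σ ℝ)
    (v : σ → ℝ) : Matrix σ σ ℝ :=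
  Matrix.of fun i j => A i j * v j / (perronRoot A * v i)

/-! ## Rate functions of finite Markov chains -/

/-- The tilted matrix `Π(y)` with entries `p_ij exp ⟨y, f j⟩`. -/
noncomputable def tiltedMatrix {α σ : Type*} [Fintype α] (P : Matrix σ σ ℝ) (f : σ → α → ℝ)
    (y : α → ℝ) : Matrix σ σ ℝ :=
  Matrix.of fun i j => P i j * Real.exp (∑ a, y a * f j a)

/-- The large deviation rate function of the empirical means of `f` along the Markov chain with
transition matrix `P`: the Legendre transform of `y ↦ log ρ(Π(y))`. -/
noncomputable def markovRate {α σ : Type*} [Fintype α] [Fintype σ] [DecidableEq σ]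
    (P : Matrix σ σ ℝ) (f : σ → α → ℝ) (z : α → ℝ) : EReal :=
  ⨆ y : α → ℝ, ((∑ a, y a * z a - Real.log (perronRoot (tiltedMatrix P f y)) : ℝ) : EReal)

/-- The supremum over strictly positive row vectors `u` of `∑ r_j log (u_j / (u P)_j)`. -/
noncomputable def sanovRate {σ : Type*} [Fintype σ] (P : Matrix σ σ ℝ) (r : σ → ℝ) : EReal :=
  ⨆ u : {u : σ → ℝ // ∀ j, 0 < u j},
    ((∑ j, r j * Real.log (u.1 j / Matrix.vecMul u.1 P j) : ℝ) : EReal)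

/-! ## Spectral radius and powers of real matrices -/

section Spectral

open Filter Topology

variable {σ : Type*} [Fintype σ] [DecidableEq σ]

/-! Let `W(y)` have entries `a_ij exp (y_j)`. Since the letter of an edge names its endpoint, the
words labelling paths from a fixed state correspond to the paths, and `(W(y) ^ n) s t` is the sum of
`exp ⟨y, i⟩` over the words of length `n` from `s` to `t`, where `i` is the letter count. The tilted
Parry matrix is `W(y) / ρ` conjugated by `diag v`, so `log ρ(Π(y)) = log ρ(W(y)) - log ρ`, and the
first identity says that `ψ(r)` is the infimum over `y` of `log ρ(W(y)) - ⟨y, r⟩`.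

The bound of `ψ` from above is Chernoff's: Gelfand's formula bounds `γ_i exp ⟨y, i⟩`, and
`exists_coneExponent_le` reads this off in a thin half-space cone around `r`. The bound from below
is convex duality. Loops at a state `q` can be concatenated, so their counts `G` are
supermultiplicative and the realized pairs (direction, exponent) form a closed convex cone. A pair
outside it is separated by Hahn-Banach, which yields some `y` with `G i * exp ⟨y, i⟩ ≤ 1` for all
`i`; then `ρ(W(y)) ≤ 1`, and this excludes exponents below the infimum
(`mem_growthCone_pathLanguage`).

The second identity is a Collatz-Wielandt principle: `ρ(B)` is the infimum of the `c` for which some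
`u ≫ 0` has `u B ≤ c u`. The vectors `y` and `u` are exchanged through `y_j = log (u_j / (u P)_j)`.
-/

open scoped Matrix.Norms.Operator in
theorem spectralRadius_ne_top (a : Matrix σ σ ℂ) : spectralRadius ℂ a ≠ ⊤ := by
  have h := spectrum.spectralRadius_le_pow_nnnorm_pow_one_div ℂ a 0
  refine ne_top_of_le_ne_top ?_ h
  simp [← ENNReal.coe_mul]

theorem perronRoot_nonneg (B : Matrix σ σ ℝ) : 0 ≤ perronRoot B := ENNReal.toReal_nonneg

theorem ofReal_map_pow (B : Matrix σ σ ℝ) (n : ℕ) :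
    (B.map (fun x : ℝ => (x : ℂ))) ^ n = (B ^ n).map (fun x : ℝ => (x : ℂ)) :=
  (Matrix.map_pow B Complex.ofRealHom n).symm

open scoped Matrix.Norms.Operator in
theorem abs_entry_le_norm_map (B : Matrix σ σ ℝ) (i j : σ) :
    |B i j| ≤ ‖B.map (fun x : ℝ => (x : ℂ))‖ := by
  rw [Matrix.linfty_opNorm_def]
  have h1 : ‖(B i j : ℂ)‖₊ ≤ ∑ j, ‖B.map (fun x : ℝ => (x : ℂ)) i j‖₊ :=
    Finset.single_le_sum (f := fun j => ‖B.map (fun x : ℝ => (x : ℂ)) i j‖₊)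
      (fun _ _ => zero_le) (Finset.mem_univ j)
  have h2 := h1.trans (Finset.le_sup (f := fun i => ∑ j, ‖B.map (fun x : ℝ => (x : ℂ)) i j‖₊)
    (Finset.mem_univ i))
  have h3 : ‖(B i j : ℂ)‖ = |B i j| := by simp
  rw [← h3]
  exact_mod_cast h2

open scoped Matrix.Norms.Operator in
theorem norm_map_le_of_entry_le {B : Matrix σ σ ℝ} {K : ℝ} (hK : 0 ≤ K)
    (h : ∀ i j, |B i j| ≤ K) :
    ‖B.map (fun x : ℝ => (x : ℂ))‖ ≤ Fintype.card σ * K := by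
  rw [Matrix.linfty_opNorm_def]
  lift K to NNReal using hK
  have : (Finset.univ.sup fun i => ∑ j, ‖B.map (fun x : ℝ => (x : ℂ)) i j‖₊)
      ≤ Fintype.card σ * K := by
    refine Finset.sup_le fun i _ => ?_
    refine (Finset.sum_le_card_nsmul _ _ K fun j _ => ?_).trans_eq ?_
    · rw [← NNReal.coe_le_coe]
      simpa using h i j
    · simp
  exact_mod_cast this

-- Gelfand's formula; the constant `C` absorbs the finitely many powers before the asymptotic
-- regime.
open scoped Matrix.Norms.Operator in
theorem exists_abs_pow_entry_le (B : Matrix σ σ ℝ) {s : ℝ} (hs : perronRoot B < s) :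
    ∃ C : ℝ, 0 < C ∧ ∀ n i j, |(B ^ n) i j| ≤ C * s ^ n := by
  have hs0 : 0 < s := (perronRoot_nonneg B).trans_lt hs
  set a := B.map (fun x : ℝ => (x : ℂ)) with ha
  have hlt : spectralRadius ℂ a < ENNReal.ofReal s :=
    (ENNReal.lt_ofReal_iff_toReal_lt (spectralRadius_ne_top a)).2 hs
  have hev : ∀ᶠ n : ℕ in atTop, ‖a ^ n‖ / s ^ n ≤ 1 := by
    filter_upwards [(spectrum.pow_norm_pow_one_div_tendsto_nhds_spectralRadius a).eventually
      (gt_mem_nhds hlt), eventually_gt_atTop 0] with n hn hn0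
    have h1 : ‖a ^ n‖ ^ (1 / n : ℝ) < s := (ENNReal.ofReal_lt_ofReal_iff hs0).1 hn
    rw [div_le_one (by positivity)]
    have h2 := pow_le_pow_left₀ (by positivity) h1.le n
    rwa [← Real.rpow_natCast, ← Real.rpow_mul (norm_nonneg _), one_div,
      inv_mul_cancel₀ (by positivity), Real.rpow_one] at h2
  obtain ⟨C, hC⟩ := (isBoundedUnder_of_eventually_le hev).bddAbove_range
  refine ⟨max C 1, by positivity, fun n i j => ?_⟩
  have h1 : ‖a ^ n‖ / s ^ n ≤ max C 1 := (hC ⟨n, rfl⟩).trans (le_max_left _ _)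
  rw [div_le_iff₀ (by positivity), ha, ofReal_map_pow] at h1
  exact (abs_entry_le_norm_map _ i j).trans h1

open scoped Matrix.Norms.Operator in
theorem perronRoot_pow_le (B : Matrix σ σ ℝ) {n : ℕ} (hn : n ≠ 0) :
    perronRoot B ^ n ≤ ‖(B ^ n).map (fun x : ℝ => (x : ℂ))‖ * ‖(1 : Matrix σ σ ℂ)‖ := by
  rw [← ofReal_map_pow]
  set a := B.map (fun x : ℝ => (x : ℂ)) with ha
  have h1 := (spectrum.spectralRadius_pow_le (𝕜 := ℂ) a n hn).trans
    (spectrum.spectralRadius_le_pow_nnnorm_pow_one_div ℂ (a ^ n) 0)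
  simp only [zero_add, pow_one, Nat.cast_zero, div_one, ENNReal.rpow_one] at h1
  have h2 := ENNReal.toReal_mono (by simp [← ENNReal.coe_mul]) h1
  simpa [perronRoot, ENNReal.toReal_pow] using h2

/-- The polynomial factor leaves room for the number of letter counts of words of length `n`; it is
beaten by the geometric decay of `(c / ρ) ^ n`. -/
theorem perronRoot_le_of_pow_entry_le (B : Matrix σ σ ℝ) {K c : ℝ} (d : ℕ) (hK : 0 ≤ K)
    (hc : 0 < c) (h : ∀ (n : ℕ) i j, |(B ^ n) i j| ≤ K * (n + 1) ^ d * c ^ n) : perronRoot B ≤ c := by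
  by_contra! hlt
  set ρ := perronRoot B
  have hρ : 0 < ρ := hc.trans hlt
  obtain ⟨D, hD⟩ : ∃ D : ℝ, ∀ n : ℕ, n ≠ 0 → ρ ^ n ≤ D * ((n + 1) ^ d * c ^ n) := by
    open scoped Matrix.Norms.Operator in
    refine ⟨Fintype.card σ * K * ‖(1 : Matrix σ σ ℂ)‖, fun n hn => ?_⟩
    refine (perronRoot_pow_le B hn).trans ?_
    have := norm_map_le_of_entry_le (B := B ^ n) (by positivity) (h n)
    calc _ ≤ (Fintype.card σ * (K * (n + 1) ^ d * c ^ n)) * ‖(1 : Matrix σ σ ℂ)‖ := by gcongr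
      _ = _ := by ring
  have ht := (tendsto_pow_const_mul_const_pow_of_abs_lt_one d (r := c / ρ)
    (by rw [abs_of_pos (by positivity), div_lt_one hρ]; exact hlt)).comp (tendsto_add_atTop_nat 1)
  have ht2 := ht.const_mul (D * (ρ / c))
  rw [mul_zero] at ht2
  obtain ⟨n, hn, hn0⟩ := ((ht2.eventually (gt_mem_nhds one_pos)).and (eventually_ne_atTop 0)).exists
  have h3 := hD n hn0
  simp only [Function.comp_apply, Nat.cast_add, Nat.cast_one] at hn
  have : D * (ρ / c) * ((n + 1) ^ d * (c / ρ) ^ (n + 1)) = D * ((n + 1) ^ d * c ^ n) / ρ ^ n := by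
    rw [pow_succ, div_pow]; field_simp
  rw [this, div_lt_one (by positivity)] at hn
  linarith

/-- A matrix all of whose pairs of indices are joined by a positive entry of a positive power. -/
def HasPosPowers (B : Matrix σ σ ℝ) : Prop := ∀ i j, ∃ n, n ≠ 0 ∧ 0 < (B ^ n) i j

theorem pow_entry_nonneg {B : Matrix σ σ ℝ} (hB : ∀ i j, 0 ≤ B i j) (n : ℕ) (i j : σ) :
    0 ≤ (B ^ n) i j := by
  induction n generalizing i j with
  | zero => rw [pow_zero, Matrix.one_apply]; split_ifs <;> simp
  | succ n ih =>
    rw [pow_succ, Matrix.mul_apply]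
    exact Finset.sum_nonneg fun k _ => mul_nonneg (ih i k) (hB k j)

theorem pow_entry_mul_le {B : Matrix σ σ ℝ} (hB : ∀ i j, 0 ≤ B i j) (m n : ℕ) (i j k : σ) :
    (B ^ m) i j * (B ^ n) j k ≤ (B ^ (m + n)) i k := by
  rw [pow_add, Matrix.mul_apply]
  exact Finset.single_le_sum (f := fun j => (B ^ m) i j * (B ^ n) j k)
    (fun j _ => mul_nonneg (pow_entry_nonneg hB _ _ _) (pow_entry_nonneg hB _ _ _))
    (Finset.mem_univ j)

/-- A walk from `i` to `j` is completed to a loop at `q` by fixed walks from `q` to `i` and from `j`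
to `q`, so one diagonal entry controls all entries. -/
theorem HasPosPowers.perronRoot_le {B : Matrix σ σ ℝ} (hpos : HasPosPowers B)
    (hB : ∀ i j, 0 ≤ B i j) (q : σ) {K c : ℝ} (d : ℕ) (hK : 0 ≤ K) (hc : 0 < c)
    (h : ∀ n : ℕ, (B ^ n) q q ≤ K * (n + 1) ^ d * c ^ n) : perronRoot B ≤ c := by
  choose a _ ha using fun i => hpos q i
  choose b _ hb using fun i => hpos i q
  set D : σ → σ → ℝ := fun i j =>
    K * (a i + b j + 1) ^ d * c ^ (a i + b j) / ((B ^ a i) q i * (B ^ b j) j q) with hDdef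
  have hD0 : ∀ i j, 0 ≤ D i j := fun i j => by
    have := ha i; have := hb j
    positivity
  have hD : ∀ (n : ℕ) i j, (B ^ n) i j ≤ D i j * (n + 1) ^ d * c ^ n := by
    intro n i j
    have h1 : (B ^ a i) q i * (B ^ n) i j * (B ^ b j) j q ≤ (B ^ (a i + n + b j)) q q :=
      (mul_le_mul_of_nonneg_right (pow_entry_mul_le hB _ _ _ _ _) (hb j).le).trans
        (pow_entry_mul_le hB _ _ _ _ _)
    have h2 : (B ^ (a i + n + b j)) q q
        ≤ K * ((a i + b j + 1) * (n + 1)) ^ d * c ^ (a i + n + b j) := by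
      refine (h _).trans ?_
      gcongr
      push_cast
      nlinarith [mul_nonneg (Nat.cast_nonneg (α := ℝ) (a i)) (Nat.cast_nonneg (α := ℝ) n),
        mul_nonneg (Nat.cast_nonneg (α := ℝ) (b j)) (Nat.cast_nonneg (α := ℝ) n)]
    have hp : 0 < (B ^ a i) q i * (B ^ b j) j q := mul_pos (ha i) (hb j)
    have h3 : D i j * (n + 1) ^ d * c ^ n
        = K * ((a i + b j + 1) * (n + 1)) ^ d * c ^ (a i + n + b j) /
          ((B ^ a i) q i * (B ^ b j) j q) := by
      simp only [hDdef]
      rw [mul_pow, pow_add c (a i + n), pow_add c (a i) n, pow_add c (a i)]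
      ring
    rw [h3, le_div_iff₀ hp]
    linarith
  refine perronRoot_le_of_pow_entry_le B (K := ∑ i, ∑ j, D i j) d
    (Finset.sum_nonneg fun i _ => Finset.sum_nonneg fun j _ => hD0 i j) hc fun n i j => ?_
  rw [abs_of_nonneg (pow_entry_nonneg hB _ _ _)]
  refine (hD n i j).trans ?_
  gcongr
  exact (Finset.single_le_sum (f := fun j => D i j) (fun j _ => hD0 i j) (Finset.mem_univ j)).trans
    (Finset.single_le_sum (f := fun i => ∑ j, D i j)
      (fun i _ => Finset.sum_nonneg fun j _ => hD0 i j) (Finset.mem_univ i))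

/-- Repeating one loop of positive weight forces exponential growth at a positive rate, whereas root
`0` would allow decay faster than any geometric sequence. -/
theorem HasPosPowers.perronRoot_pos [Nonempty σ] {B : Matrix σ σ ℝ} (hpos : HasPosPowers B)
    (hB : ∀ i j, 0 ≤ B i j) : 0 < perronRoot B := by
  obtain ⟨q⟩ := ‹Nonempty σ›
  obtain ⟨N, hN, hq⟩ := hpos q q
  refine lt_of_le_of_ne (perronRoot_nonneg B) fun h0 => ?_
  obtain ⟨s, hs0, hs⟩ : ∃ s : ℝ, 0 < s ∧ s ^ N < (B ^ N) q q := by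
    have : Tendsto (fun s : ℝ => s ^ N) (𝓝[>] 0) (𝓝 0) := by
      have h := (continuous_pow N (M := ℝ)).tendsto 0
      rw [zero_pow hN] at h
      exact h.mono_left nhdsWithin_le_nhds
    obtain ⟨s, h1, h2⟩ := ((this.eventually (gt_mem_nhds hq)).and self_mem_nhdsWithin).exists
    exact ⟨s, h2, h1⟩
  obtain ⟨C, hC, hb⟩ := exists_abs_pow_entry_le B (s := s) (by rwa [← h0])
  have hk : ∀ k : ℕ, ((B ^ N) q q) ^ k ≤ (B ^ (N * k)) q q := by
    intro k
    induction k with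
    | zero => simp
    | succ k ih =>
      rw [pow_succ, Nat.mul_succ]
      exact (mul_le_mul_of_nonneg_right ih hq.le).trans (pow_entry_mul_le hB _ _ _ _ _)
  have hlt : 1 < (B ^ N) q q / s ^ N := (one_lt_div (by positivity)).2 hs
  obtain ⟨k, hk2⟩ := pow_unbounded_of_one_lt C hlt
  have h3 := (hk k).trans ((le_abs_self _).trans (hb (N * k) q q))
  rw [div_pow, lt_div_iff₀ (by positivity), ← pow_mul] at hk2
  linarith

theorem perronRoot_le_of_vecMul_le {B : Matrix σ σ ℝ} (hB : ∀ i j, 0 ≤ B i j) {u : σ → ℝ}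
    (hu : ∀ i, 0 < u i) {c : ℝ} (hc : 0 < c) (h : ∀ j, Matrix.vecMul u B j ≤ c * u j) :
    perronRoot B ≤ c := by
  have hn : ∀ n j, Matrix.vecMul u (B ^ n) j ≤ c ^ n * u j := by
    intro n
    induction n with
    | zero => simp
    | succ n ih =>
      intro j
      rw [pow_succ, ← Matrix.vecMul_vecMul]
      calc _ ≤ Matrix.vecMul (fun i => c ^ n * u i) B j :=
            Finset.sum_le_sum fun i _ => mul_le_mul_of_nonneg_right (ih i) (hB i j)
        _ = c ^ n * Matrix.vecMul u B j := by
            simp only [Matrix.vecMul, dotProduct, Finset.mul_sum, mul_assoc]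
        _ ≤ c ^ n * (c * u j) := by gcongr; exact h j
        _ = _ := by ring
  have hK0 : ∀ i j, 0 ≤ u j / u i := fun i j => (div_pos (hu j) (hu i)).le
  refine perronRoot_le_of_pow_entry_le B (K := ∑ i, ∑ j, u j / u i) 0
    (Finset.sum_nonneg fun i _ => Finset.sum_nonneg fun j _ => hK0 i j) hc fun n i j => ?_
  rw [abs_of_nonneg (pow_entry_nonneg hB _ _ _), pow_zero, mul_one]
  have h1 : u i * (B ^ n) i j ≤ c ^ n * u j :=
    (Finset.single_le_sum (f := fun i => u i * (B ^ n) i j)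
      (fun i _ => mul_nonneg (hu i).le (pow_entry_nonneg hB _ _ _)) (Finset.mem_univ i)).trans
      (hn n j)
  calc (B ^ n) i j ≤ u j / u i * c ^ n := by
        rw [div_mul_eq_mul_div, le_div_iff₀ (hu i)]; linarith
    _ ≤ _ := by
        gcongr
        exact (Finset.single_le_sum (f := fun j => u j / u i) (fun j _ => hK0 i j)
          (Finset.mem_univ j)).trans (Finset.single_le_sum (f := fun i => ∑ j, u j / u i)
          (fun i _ => Finset.sum_nonneg fun j _ => hK0 i j) (Finset.mem_univ i))

/-- A truncated Neumann series replaces the Perron eigenvector. With `w n = 1 B ^ n / s ^ n` and `u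
= ∑ n < N, w n`, the sum telescopes to `u B = s (u - w 0 + w N)`, and `w N ≤ 1 = w 0` for a suitable
`N`. The term `w 0` makes `u` positive. -/
theorem exists_vecMul_le_of_perronRoot_lt {B : Matrix σ σ ℝ} (hB : ∀ i j, 0 ≤ B i j) {s : ℝ}
    (hs : perronRoot B < s) :
    ∃ u : σ → ℝ, (∀ i, 0 < u i) ∧ ∀ j, Matrix.vecMul u B j ≤ s * u j := by
  have hs0 : 0 < s := (perronRoot_nonneg B).trans_lt hs
  obtain ⟨s', h1, h2⟩ := exists_between hs
  have hs'0 : 0 < s' := (perronRoot_nonneg B).trans_lt h1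
  obtain ⟨C, hC, hb⟩ := exists_abs_pow_entry_le B h1
  set w : ℕ → σ → ℝ := fun n => (s ^ n)⁻¹ • Matrix.vecMul (fun _ => 1) (B ^ n) with hw
  have hw0 : ∀ n j, 0 ≤ w n j := fun n j =>
    mul_nonneg (by positivity) (Finset.sum_nonneg fun i _ =>
      mul_nonneg zero_le_one (pow_entry_nonneg hB _ _ _))
  have hwB : ∀ n, Matrix.vecMul (w n) B = s • w (n + 1) := by
    intro n
    simp only [hw, Matrix.smul_vecMul, Matrix.vecMul_vecMul, ← pow_succ, smul_smul]
    congr 1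
    field_simp
    exact pow_succ s n
  have hwN : ∃ N, N ≠ 0 ∧ ∀ j, w N j ≤ 1 := by
    have ht := (tendsto_pow_atTop_nhds_zero_of_lt_one (r := s' / s) (by positivity)
      ((div_lt_one hs0).2 h2)).const_mul (Fintype.card σ * C)
    rw [mul_zero] at ht
    obtain ⟨N, hN, hN0⟩ :=
      ((ht.eventually (gt_mem_nhds one_pos)).and (eventually_ne_atTop 0)).exists
    refine ⟨N, hN0, fun j => ?_⟩
    have h3 : Matrix.vecMul (fun _ => 1) (B ^ N) j ≤ Fintype.card σ * (C * s' ^ N) := by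
      refine (Finset.sum_le_card_nsmul _ _ (C * s' ^ N) fun i _ => ?_).trans_eq (by simp)
      rw [one_mul]
      exact (le_abs_self _).trans (hb N i j)
    calc w N j ≤ (s ^ N)⁻¹ * (Fintype.card σ * (C * s' ^ N)) := by
          simp only [hw, Pi.smul_apply, smul_eq_mul]; gcongr
      _ = Fintype.card σ * C * (s' / s) ^ N := by rw [div_pow]; ring
      _ ≤ 1 := hN.le
  obtain ⟨N, hN0, hN⟩ := hwN
  have hw00 : ∀ j, w 0 j = 1 := fun j => by simp [hw]
  refine ⟨fun j => ∑ n ∈ Finset.range N, w n j, fun j => ?_, fun j => ?_⟩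
  · have : w 0 j ≤ ∑ n ∈ Finset.range N, w n j :=
      Finset.single_le_sum (f := fun n => w n j) (fun n _ => hw0 n j)
        (Finset.mem_range.2 (Nat.pos_of_ne_zero hN0))
    rw [hw00] at this
    linarith
  · have hsum : (fun j => ∑ n ∈ Finset.range N, w n j) = ∑ n ∈ Finset.range N, w n := by
      ext j; simp
    have hv : Matrix.vecMul (∑ n ∈ Finset.range N, w n) B
        = ∑ n ∈ Finset.range N, Matrix.vecMul (w n) B := by
      ext j
      simp only [Matrix.vecMul, dotProduct, Finset.sum_apply, Finset.sum_mul]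
      exact Finset.sum_comm
    rw [hsum, hv, Finset.sum_apply]
    simp only [hwB, Pi.smul_apply, smul_eq_mul, ← Finset.mul_sum]
    gcongr
    have e1 := Finset.sum_range_succ (fun n => w n j) N
    have e2 := Finset.sum_range_succ' (fun n => w n j) N
    rw [hw00] at e2
    have := hN j
    rw [Finset.sum_apply]
    linarith

end Spectral

/-! ## Counting words by their letters -/

section Counting

variable {α : Type*} [Fintype α] [DecidableEq α]

theorem List.sum_map_eq_sum_count_mul (y : α → ℝ) (w : List α) :
    (w.map y).sum = ∑ a, y a * (w.count a : ℝ) := by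
  induction w with
  | nil => simp
  | cons b w ih =>
    simp only [List.map_cons, List.sum_cons, ih, List.count_cons, Nat.cast_add, mul_add,
      Finset.sum_add_distrib]
    rw [add_comm]
    simp

theorem List.sum_count_eq_length (w : List α) : ∑ a, w.count a = w.length := by
  have := List.sum_map_eq_sum_count_mul (fun _ : α => (1 : ℝ)) w
  simp only [List.map_const', List.sum_replicate, one_mul, nsmul_eq_mul, mul_one] at this
  exact_mod_cast this.symm

open Classical in
theorem growthCoeff_eq_card (L : Language α) (i : α → ℕ) {n : ℕ} (hn : ∑ a, i a = n) :
    growthCoeff L i = (Finset.univ.filter fun f : Fin n → α =>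
      List.ofFn f ∈ L ∧ ∀ a, (List.ofFn f).count a = i a).card := by
  rw [← Set.ncard_coe_finset, ← Set.ncard_image_of_injective _ List.ofFn_injective, growthCoeff]
  congr 1
  ext w
  simp only [Set.mem_ofPred_eq, Finset.coe_filter, Finset.mem_univ, true_and, Set.mem_image]
  constructor
  · rintro ⟨h1, h2⟩
    have hw : w.length = n := by
      rw [← List.sum_count_eq_length, ← hn]
      exact Finset.sum_congr rfl fun a _ => h2 a
    subst hw
    exact ⟨w.get, by simpa using ⟨h1, h2⟩, by simp⟩
  · rintro ⟨f, h, rfl⟩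
    exact h

theorem finite_words_count_eq (L : Language α) (i : α → ℕ) :
    {w : List α | w ∈ L ∧ ∀ a, w.count a = i a}.Finite := by
  refine (List.finite_length_eq α (∑ a, i a)).subset ?_
  rintro w ⟨-, h⟩
  rw [Set.mem_ofPred_eq, ← List.sum_count_eq_length]
  exact Finset.sum_congr rfl fun a _ => h a

theorem growthCoeff_mono {L L' : Language α} (h : L ≤ L') (i : α → ℕ) :
    growthCoeff L i ≤ growthCoeff L' i :=
  Set.ncard_le_ncard (fun _ hw => ⟨h hw.1, hw.2⟩) (finite_words_count_eq L' i)

theorem one_le_growthCoeff {L : Language α} {w : List α} (h : w ∈ L) :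
    1 ≤ growthCoeff L (fun a => w.count a) :=
  (Set.ncard_pos (finite_words_count_eq _ _)).2 ⟨w, h, fun _ => rfl⟩

/-- Prescribed letter counts fix the length of the first factor, so concatenation is injective here.
-/
theorem growthCoeff_mul_le (L L' : Language α) (i j : α → ℕ) :
    growthCoeff L i * growthCoeff L' j ≤ growthCoeff (L * L') (i + j) := by
  rw [growthCoeff, growthCoeff, ← Set.ncard_prod]
  refine Set.ncard_le_ncard_of_injOn (fun p => p.1 ++ p.2) ?_ ?_ (finite_words_count_eq _ _)
  · rintro ⟨u, w⟩ ⟨⟨h1, h2⟩, h3, h4⟩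
    exact ⟨Language.append_mem_mul h1 h3, fun a => by simp [List.count_append, h2, h4]⟩
  · rintro ⟨u, w⟩ ⟨⟨-, h2⟩, -, -⟩ ⟨u', w'⟩ ⟨⟨-, h2'⟩, -, -⟩ h
    have hl : u.length = u'.length := by
      rw [← List.sum_count_eq_length, ← List.sum_count_eq_length]
      exact Finset.sum_congr rfl fun a _ => (h2 a).trans (h2' a).symm
    obtain ⟨rfl, rfl⟩ := List.append_inj h hl
    rfl

end Counting

/-! ### Words along paths and powers of the weighted adjacency matrix. -/

section Paths

variable {α σ : Type*}

/-- The words that label a path from `s` to `t`. -/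
def NFA.pathLanguage (M : NFA α σ) (s t : σ) : Language α := {w | t ∈ M.evalFrom {s} w}

theorem NFA.mem_pathLanguage {M : NFA α σ} {s t : σ} {w : List α} :
    w ∈ M.pathLanguage s t ↔ t ∈ M.evalFrom {s} w := Iff.rfl

theorem NFA.pathLanguage_mul_le (M : NFA α σ) (p q s : σ) :
    M.pathLanguage p q * M.pathLanguage q s ≤ M.pathLanguage p s := by
  intro w hw
  obtain ⟨u, hu, u', hu', rfl⟩ := Language.mem_mul.1 hw
  change u ++ u' ∈ M.pathLanguage p s
  rw [NFA.mem_pathLanguage, NFA.evalFrom_append, NFA.mem_evalFrom_iff_exists]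
  exact ⟨q, hu, hu'⟩

theorem NFA.pathLanguage_le_accepts {M : NFA α σ} {s t : σ} (hs : s ∈ M.start)
    (ht : t ∈ M.accept) : M.pathLanguage s t ≤ M.accepts := by
  intro w hw
  exact NFA.mem_accepts.2 ⟨t, ht, NFA.mem_evalFrom_iff_exists.2 ⟨s, hs, hw⟩⟩

theorem growthCoeff_accepts_le [Fintype α] [DecidableEq α] [Fintype σ] (M : NFA α σ)
    (i : α → ℕ) :
    growthCoeff M.accepts i ≤ ∑ s, ∑ t, growthCoeff (M.pathLanguage s t) i := by
  classical
  have hsub : {w : List α | w ∈ M.accepts ∧ ∀ a, w.count a = i a} ⊆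
      ⋃ p ∈ (Finset.univ : Finset (σ × σ)),
        {w : List α | w ∈ M.pathLanguage p.1 p.2 ∧ ∀ a, w.count a = i a} := by
    rintro w ⟨hw, hc⟩
    obtain ⟨t, -, ht⟩ := NFA.mem_accepts.1 hw
    obtain ⟨s, -, hs⟩ := NFA.mem_evalFrom_iff_exists.1 ht
    simp only [Set.mem_iUnion]
    exact ⟨(s, t), Finset.mem_univ _, hs, hc⟩
  refine (Set.ncard_le_ncard hsub
    (Set.Finite.biUnion (Finset.finite_toSet _) fun p _ => finite_words_count_eq _ _)).trans ?_
  refine (Finset.set_ncard_biUnion_le _ _).trans_eq ?_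
  rw [← Finset.univ_product_univ, Finset.sum_product]
  rfl

/-- The adjacency matrix in which every edge carrying the letter `a` has the weight `exp (y a)`. -/
noncomputable def weightedAdjacency (M : NFA α σ) (label : σ ≃ α) (y : α → ℝ) : Matrix σ σ ℝ :=
  Matrix.of fun s t => adjacencyMatrix M s t * Real.exp (y (label t))

open Classical in
theorem adjacencyMatrix_apply_of_label {M : NFA α σ} {label : σ ≃ α}
    (hlabel : ∀ (s t : σ) (a : α), t ∈ M.step s a → label t = a) (s t : σ) :
    adjacencyMatrix M s t = if t ∈ M.step s (label t) then 1 else 0 := by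
  rw [adjacencyMatrix, Matrix.of_apply]
  split_ifs with h
  · have : {a : α | t ∈ M.step s a} = {label t} := by
      ext a
      exact ⟨fun ha => (hlabel s t a ha).symm, fun ha => by rw [Set.mem_singleton_iff.1 ha]; exact h⟩
    rw [this, Set.ncard_singleton, Nat.cast_one]
  · have : {a : α | t ∈ M.step s a} = ∅ := by
      ext a
      refine ⟨fun ha => h ?_, fun ha => ha.elim⟩
      rwa [hlabel s t a ha]
    rw [this, Set.ncard_empty, Nat.cast_zero]

theorem cons_mem_pathLanguage_iff {M : NFA α σ} {label : σ ≃ α}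
    (hlabel : ∀ (s t : σ) (a : α), t ∈ M.step s a → label t = a) (s p t : σ) (w : List α) :
    label p :: w ∈ M.pathLanguage s t ↔ p ∈ M.step s (label p) ∧ w ∈ M.pathLanguage p t := by
  rw [NFA.mem_pathLanguage, NFA.evalFrom_cons, NFA.stepSet_singleton, NFA.mem_evalFrom_iff_exists]
  constructor
  · rintro ⟨p', h1, h2⟩
    obtain rfl := label.injective (hlabel _ _ _ h1)
    exact ⟨h1, h2⟩
  · rintro ⟨h1, h2⟩
    exact ⟨p, h1, h2⟩

theorem adjacencyMatrix_nonneg (M : NFA α σ) (s t : σ) : 0 ≤ adjacencyMatrix M s t := by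
  rw [adjacencyMatrix, Matrix.of_apply]
  positivity

theorem adjacencyMatrix_pos [Finite α] (M : NFA α σ) {s t : σ} (h : ∃ a, t ∈ M.step s a) :
    0 < adjacencyMatrix M s t := by
  rw [adjacencyMatrix, Matrix.of_apply]
  exact_mod_cast (Set.ncard_pos (Set.toFinite _)).2 h

theorem IsErgodicAutomaton.exists_mem_pathLanguage {M : NFA α σ} (hM : IsErgodicAutomaton M)
    (s t : σ) : ∃ w, w ∈ M.pathLanguage s t := by
  induction hM s t with
  | single h =>
    obtain ⟨a, ha⟩ := h
    exact ⟨[a], by simpa [NFA.mem_pathLanguage] using ha⟩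
  | tail _ h ih =>
    obtain ⟨a, ha⟩ := h
    obtain ⟨w, hw⟩ := ih
    refine ⟨w ++ [a], NFA.pathLanguage_mul_le M _ _ _ (Language.append_mem_mul hw ?_)⟩
    simpa [NFA.mem_pathLanguage] using ha

variable [Fintype σ] [DecidableEq σ]

theorem IsErgodicAutomaton.hasPosPowers {M : NFA α σ} (hM : IsErgodicAutomaton M)
    {B : Matrix σ σ ℝ} (hB : ∀ i j, 0 ≤ B i j)
    (hpos : ∀ s t, (∃ a, t ∈ M.step s a) → 0 < B s t) : HasPosPowers B := by
  intro s t
  induction hM s t with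
  | single h => exact ⟨1, one_ne_zero, by rw [pow_one]; exact hpos _ _ h⟩
  | @tail p t _ h ih =>
    obtain ⟨n, -, h1⟩ := ih
    refine ⟨n + 1, n.succ_ne_zero, lt_of_lt_of_le ?_ (pow_entry_mul_le hB n 1 s p t)⟩
    rw [pow_one]
    exact mul_pos h1 (hpos _ _ h)

variable [Fintype α]

-- Each word contributes at most once: by injectivity of `label` its letters determine the states
-- visited after the starting one.
open Classical in
theorem weightedAdjacency_pow_apply {M : NFA α σ} {label : σ ≃ α}
    (hlabel : ∀ (s t : σ) (a : α), t ∈ M.step s a → label t = a) (y : α → ℝ) (n : ℕ) (s t : σ) :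
    (weightedAdjacency M label y ^ n) s t =
      ∑ f : Fin n → α, if List.ofFn f ∈ M.pathLanguage s t
        then Real.exp (((List.ofFn f).map y).sum) else 0 := by
  induction n generalizing s with
  | zero =>
    rw [Fintype.sum_unique]
    simp [NFA.mem_pathLanguage, Matrix.one_apply, eq_comm]
  | succ n ih =>
    rw [pow_succ', Matrix.mul_apply, ← (Fin.consEquiv fun _ => α).sum_comp,
      Fintype.sum_prod_type, ← label.sum_comp]
    refine Finset.sum_congr rfl fun p _ => ?_
    rw [ih, Finset.mul_sum]
    refine Finset.sum_congr rfl fun f _ => ?_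
    rw [weightedAdjacency, Matrix.of_apply, adjacencyMatrix_apply_of_label hlabel]
    simp only [Fin.consEquiv, Equiv.coe_fn_mk, List.ofFn_cons, List.map_cons, List.sum_cons,
      cons_mem_pathLanguage_iff hlabel, Real.exp_add]
    by_cases h1 : p ∈ M.step s (label p) <;> by_cases h2 : List.ofFn f ∈ M.pathLanguage p t <;>
      simp [h1, h2]

variable [DecidableEq α]

theorem growthCoeff_mul_exp_le {M : NFA α σ} {label : σ ≃ α}
    (hlabel : ∀ (s t : σ) (a : α), t ∈ M.step s a → label t = a) (y : α → ℝ) (s t : σ)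
    (i : α → ℕ) :
    growthCoeff (M.pathLanguage s t) i * Real.exp (∑ a, y a * i a) ≤
      (weightedAdjacency M label y ^ (∑ a, i a)) s t := by
  classical
  rw [weightedAdjacency_pow_apply hlabel, growthCoeff_eq_card _ _ rfl, ← Finset.sum_filter,
    ← nsmul_eq_mul, ← Finset.sum_const]
  have hw : ∀ f ∈ Finset.univ.filter fun f : Fin (∑ a, i a) → α =>
      List.ofFn f ∈ M.pathLanguage s t ∧ ∀ a, (List.ofFn f).count a = i a,
      Real.exp (∑ a, y a * i a) = Real.exp (((List.ofFn f).map y).sum) := by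
    intro f hf
    rw [List.sum_map_eq_sum_count_mul]
    simp only [(Finset.mem_filter.1 hf).2.2]
  rw [Finset.sum_congr rfl hw]
  refine Finset.sum_le_sum_of_subset_of_nonneg ?_ fun f _ _ => (Real.exp_pos _).le
  intro f hf
  rw [Finset.mem_filter] at hf ⊢
  exact ⟨hf.1, hf.2.1⟩

/-- Words are grouped by letter count. The box also contains counts of total other than `n`; these
only enlarge the right side. -/
theorem weightedAdjacency_pow_le_sum {M : NFA α σ} {label : σ ≃ α}
    (hlabel : ∀ (s t : σ) (a : α), t ∈ M.step s a → label t = a) (y : α → ℝ) (s t : σ) (n : ℕ) :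
    (weightedAdjacency M label y ^ n) s t ≤
      ∑ i ∈ Fintype.piFinset fun _ : α => Finset.range (n + 1),
        growthCoeff (M.pathLanguage s t) i * Real.exp (∑ a, y a * i a) := by
  classical
  rw [weightedAdjacency_pow_apply hlabel, ← Finset.sum_filter]
  have hmaps : ∀ f ∈ Finset.univ.filter fun f : Fin n → α => List.ofFn f ∈ M.pathLanguage s t,
      (fun a => (List.ofFn f).count a) ∈ Fintype.piFinset fun _ : α => Finset.range (n + 1) := by
    intro f _
    rw [Fintype.mem_piFinset]
    intro a
    rw [Finset.mem_range, Nat.lt_succ_iff]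
    exact List.count_le_length.trans_eq (by simp)
  rw [← Finset.sum_fiberwise_of_maps_to hmaps]
  refine Finset.sum_le_sum fun i _ => ?_
  by_cases hi : ∑ a, i a = n
  · rw [growthCoeff_eq_card _ _ hi, ← nsmul_eq_mul, ← Finset.sum_const, Finset.filter_filter]
    refine le_of_eq (Finset.sum_congr ?_ ?_)
    · ext f
      simp [funext_iff]
    · intro f hf
      rw [List.sum_map_eq_sum_count_mul]
      simp only [(Finset.mem_filter.1 hf).2.2]
  · rw [Finset.sum_eq_zero]
    · positivity
    · intro f hf
      rw [Finset.mem_filter] at hf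
      refine absurd ?_ hi
      rw [← hf.2, List.sum_count_eq_length]
      simp

end Paths

/-! ## Exponents of growth of supermultiplicative families of coefficients -/

section GrowthCone

open Filter Topology

variable {α : Type*}

/-- The asymptotically realized pairs of a direction and an exponent: `(x, t)` belongs to the set
if `G` is at least `exp (R t)` at some multi-index close to `R x`, up to errors `o(R)`. -/
def growthCone (G : (α → ℕ) → ℕ) : Set ((α → ℝ) × ℝ) :=
  {p | ∀ ε > 0, ∀ᶠ R : ℝ in atTop, ∃ i : α → ℕ,
    (∀ a, |(i a : ℝ) - R * p.1 a| ≤ ε * R) ∧ Real.exp (R * (p.2 - ε)) ≤ G i}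

theorem isClosed_growthCone [Fintype α] (G : (α → ℕ) → ℕ) : IsClosed (growthCone G) := by
  refine isClosed_of_closure_subset fun p hp ε hε => ?_
  obtain ⟨q, hq, hd⟩ := Metric.mem_closure_iff.1 hp (ε / 2) (half_pos hε)
  rw [Prod.dist_eq, max_lt_iff] at hd
  filter_upwards [hq (ε / 2) (half_pos hε), eventually_gt_atTop 0] with R ⟨i, h1, h2⟩ hR
  refine ⟨i, fun a => ?_, h2.trans' (Real.exp_le_exp.2 ?_)⟩
  · have h3 : |p.1 a - q.1 a| ≤ ε / 2 := (dist_le_pi_dist p.1 q.1 a).trans hd.1.le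
    have h4 : |R * q.1 a - R * p.1 a| ≤ R * (ε / 2) := by
      rw [← mul_sub, abs_mul, abs_of_pos hR, abs_sub_comm]
      gcongr
    calc _ ≤ |(i a : ℝ) - R * q.1 a| + |R * q.1 a - R * p.1 a| := abs_sub_le _ _ _
      _ ≤ ε / 2 * R + R * (ε / 2) := add_le_add (h1 a) h4
      _ = ε * R := by ring
  · have h3 := (abs_lt.1 (Real.dist_eq p.2 q.2 ▸ hd.2)).2
    exact mul_le_mul_of_nonneg_left (by linarith) hR.le

variable {G : (α → ℕ) → ℕ}

theorem add_mem_growthCone (hG : ∀ i j, G i * G j ≤ G (i + j)) {p q : (α → ℝ) × ℝ}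
    (hp : p ∈ growthCone G) (hq : q ∈ growthCone G) : p + q ∈ growthCone G := by
  intro ε hε
  filter_upwards [hp (ε / 2) (half_pos hε), hq (ε / 2) (half_pos hε)]
    with R ⟨i, h1, h2⟩ ⟨j, h3, h4⟩
  refine ⟨i + j, fun a => ?_, ?_⟩
  · calc _ = |((i a : ℝ) - R * p.1 a) + (j a - R * q.1 a)| := by
          simp only [Pi.add_apply, Prod.fst_add, Nat.cast_add]; ring_nf
      _ ≤ ε / 2 * R + ε / 2 * R := (abs_add_le _ _).trans (add_le_add (h1 a) (h3 a))
      _ = ε * R := by ring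
  · calc _ = Real.exp (R * (p.2 - ε / 2)) * Real.exp (R * (q.2 - ε / 2)) := by
          rw [← Real.exp_add, Prod.snd_add]; ring_nf
      _ ≤ G i * G j := by gcongr
      _ ≤ G (i + j) := by exact_mod_cast hG i j

theorem smul_mem_growthCone {p : (α → ℝ) × ℝ} (hp : p ∈ growthCone G) {c : ℝ} (hc : 0 < c) :
    c • p ∈ growthCone G := by
  intro ε hε
  filter_upwards [(tendsto_id.const_mul_atTop hc).eventually (hp (ε / c) (div_pos hε hc))]
    with R ⟨i, h1, h2⟩
  simp only [id] at h1 h2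
  refine ⟨i, fun a => ?_, h2.trans' (Real.exp_le_exp.2 (le_of_eq ?_))⟩
  · convert h1 a using 1
    · rw [Prod.smul_fst, Pi.smul_apply, smul_eq_mul]; ring_nf
    · field_simp
  · rw [Prod.smul_snd, smul_eq_mul]
    field_simp

theorem convex_growthCone (hG : ∀ i j, G i * G j ≤ G (i + j)) : Convex ℝ (growthCone G) :=
  convex_iff_forall_pos.2 fun _ hp _ hq _ _ ha hb _ =>
    add_mem_growthCone hG (smul_mem_growthCone hp ha) (smul_mem_growthCone hq hb)

theorem pow_le_apply_nsmul (hG : ∀ i j, G i * G j ≤ G (i + j)) (h0 : 1 ≤ G 0) (i : α → ℕ)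
    (n : ℕ) : G i ^ n ≤ G (n • i) := by
  induction n with
  | zero => simpa using h0
  | succ n ih =>
    rw [pow_succ, succ_nsmul]
    exact (Nat.mul_le_mul_right _ ih).trans (hG _ _)

/-- The multi-index `i` is repeated `⌊R⌋₊` times; supermultiplicativity gives the exponent. -/
theorem mk_mem_growthCone [Fintype α] (hG : ∀ i j, G i * G j ≤ G (i + j)) (h0 : 1 ≤ G 0)
    {i : α → ℕ} (hi : 1 ≤ G i) :
    ((fun a => (i a : ℝ)), Real.log (G i)) ∈ growthCone G := by
  intro ε hε
  have hi' : (1 : ℝ) ≤ G i := by exact_mod_cast hi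
  have hg : 0 ≤ Real.log (G i) := Real.log_nonneg hi'
  filter_upwards [eventually_ge_atTop 0, eventually_ge_atTop ((∑ a, (i a : ℝ)) / ε),
    eventually_ge_atTop (Real.log (G i) / ε)] with R hR0 hR1 hR2
  rw [div_le_iff₀ hε] at hR1 hR2
  have h1 := Nat.floor_le hR0
  have h2 := Nat.lt_floor_add_one R
  refine ⟨⌊R⌋₊ • i, fun a => ?_, ?_⟩
  · have h3 : (i a : ℝ) ≤ ∑ a, (i a : ℝ) :=
      Finset.single_le_sum (f := fun a => (i a : ℝ)) (fun _ _ => by positivity)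
        (Finset.mem_univ a)
    have h4 : (0 : ℝ) ≤ i a := by positivity
    rw [Pi.smul_apply, smul_eq_mul, Nat.cast_mul, ← sub_mul, abs_mul, abs_of_nonneg h4,
      abs_of_nonpos (by linarith)]
    nlinarith
  · calc Real.exp (R * (Real.log (G i) - ε)) ≤ Real.exp (⌊R⌋₊ * Real.log (G i)) := by
          rw [Real.exp_le_exp]
          nlinarith
      _ = (G i : ℝ) ^ ⌊R⌋₊ := by
          rw [mul_comm, Real.exp_mul, Real.exp_log (by linarith), Real.rpow_natCast]
      _ ≤ G (⌊R⌋₊ • i) := by exact_mod_cast pow_le_apply_nsmul hG h0 i _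

/-- This downward vertical direction forces the sign of `β` in the separation. -/
theorem zero_neg_one_mem_growthCone (h0 : 1 ≤ G 0) :
    ((0 : α → ℝ), (-1 : ℝ)) ∈ growthCone G := by
  intro ε hε
  filter_upwards [eventually_ge_atTop 0] with R hR
  refine ⟨0, fun a => by simpa using by positivity, ?_⟩
  calc Real.exp (R * (-1 - ε)) ≤ 1 := Real.exp_le_one_iff.2 (by nlinarith)
    _ ≤ G 0 := by exact_mod_cast h0

/-- A pair that is not asymptotically realized is separated from the realized ones by a linear
form whose coefficient at the exponent is nonnegative. -/
theorem exists_separating_of_notMem_growthCone [Fintype α] [DecidableEq α]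
    (hG : ∀ i j, G i * G j ≤ G (i + j)) (h0 : 1 ≤ G 0) {r : α → ℝ} {t : ℝ}
    (h : (r, t) ∉ growthCone G) :
    ∃ (y : α → ℝ) (β : ℝ), 0 ≤ β ∧
      (∀ i : α → ℕ, 1 ≤ G i → ∑ a, y a * i a + β * Real.log (G i) ≤ 0) ∧
      0 < ∑ a, y a * r a + β * t := by
  obtain ⟨f, u, hf, hu⟩ :=
    geometric_hahn_banach_closed_point (convex_growthCone hG) (isClosed_growthCone G) h
  -- A linear form bounded above on a set stable under positive scaling is nonpositive there.
  have hle : ∀ p ∈ growthCone G, f p ≤ 0 := by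
    intro p hp
    by_contra! hpos
    have h1 := hf _ (smul_mem_growthCone hp (c := (|u| + 1) / f p) (by positivity))
    rw [map_smul, smul_eq_mul, div_mul_cancel₀ _ hpos.ne'] at h1
    linarith [le_abs_self u]
  have hu0 : 0 ≤ u := by
    by_contra! hneg
    have hz := zero_neg_one_mem_growthCone h0
    have h2 := hle _ hz
    rcases h2.lt_or_eq with h3 | h3
    · have h4 := hf _ (smul_mem_growthCone hz (c := u / (2 * f ((0 : α → ℝ), (-1 : ℝ))))
        (div_pos_of_neg_of_neg hneg (by linarith)))
      rw [map_smul, smul_eq_mul] at h4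
      have h5 : u / (2 * f ((0 : α → ℝ), (-1 : ℝ))) * f ((0 : α → ℝ), (-1 : ℝ)) = u / 2 := by
        have := h3.ne
        field_simp
      linarith
    · linarith [hf _ hz]
  have hval : ∀ (x : α → ℝ) (s : ℝ),
      f (x, s) = ∑ a, f (Pi.single a 1, 0) * x a + f (0, 1) * s := by
    intro x s
    have hx : (x, s) = ∑ a, x a • ((Pi.single a (1 : ℝ) : α → ℝ), (0 : ℝ)) +
        s • ((0 : α → ℝ), (1 : ℝ)) := by
      ext b
      · simp [Prod.fst_sum, Finset.sum_apply, Pi.single_apply]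
      · simp [Prod.snd_sum]
    conv_lhs => rw [hx]
    simp only [map_add, map_sum, map_smul, smul_eq_mul]
    simp only [mul_comm]
  refine ⟨fun a => f (Pi.single a 1, 0), f (0, 1), ?_, fun i hi => ?_, ?_⟩
  · have h1 := hle _ (zero_neg_one_mem_growthCone h0)
    rw [hval] at h1
    simpa using h1
  · rw [← hval]
    exact hle _ (mk_mem_growthCone hG h0 hi)
  · rw [← hval]
    linarith

end GrowthCone

/-! ### Bounds from below and above for the exponent of growth in a cone. -/

section ConeExponent

open Filter Topology

variable {α : Type*} [Fintype α]

theorem le_coneExponent_of_mem_growthCone {G γ : (α → ℕ) → ℕ} (c : α → ℕ)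
    (hγ : ∀ i, G i ≤ γ (i + c)) {r : α → ℝ} (hr : r ∈ stdSimplex ℝ α) {t : ℝ}
    (h : (r, t) ∈ growthCone G) {C : Set (α → ℝ)} (hC : IsOpenCone C) (hrC : r ∈ C) :
    (t : EReal) ≤ coneExponent γ C := by
  refine EReal.ge_of_forall_gt_iff_ge.1 fun s hs => ?_
  have hst : s < t := by exact_mod_cast hs
  obtain ⟨δ, hδ, hball⟩ := Metric.isOpen_iff.1 hC.1 r hrC
  set d : ℝ := (Fintype.card α : ℝ) with hd
  have hd0 : 0 ≤ d := by positivity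
  -- The shifted index `k` has norm `R'` within `2 * d * ε * R` of `R`. The three conditions put `k
  -- / R` in the ball inside `C`, make the loss in the exponent at most `t - s`, and give `R' ≥ R /
  -- 2`.
  obtain ⟨ε, hε, h1, h2, h3⟩ : ∃ ε : ℝ, 0 < ε ∧ 2 * ε < δ ∧ ε * (2 * d * |s| + 1) ≤ t - s ∧
      2 * d * ε ≤ 1 / 2 := by
    have hp : 0 < 2 * d * |s| + 1 := by positivity
    refine ⟨min (δ / 3) (min ((t - s) / (2 * d * |s| + 1)) (1 / (4 * d + 1))), ?_, ?_, ?_, ?_⟩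
    · have : 0 < t - s := sub_pos.2 hst
      positivity
    · linarith [min_le_left (δ / 3) (min ((t - s) / (2 * d * |s| + 1)) (1 / (4 * d + 1)))]
    · rw [← le_div_iff₀ hp]
      exact (min_le_right _ _).trans (min_le_left _ _)
    · have h4 : min (δ / 3) (min ((t - s) / (2 * d * |s| + 1)) (1 / (4 * d + 1)))
          ≤ 1 / (4 * d + 1) := (min_le_right _ _).trans (min_le_right _ _)
      calc _ ≤ 2 * d * (1 / (4 * d + 1)) := by gcongr
        _ ≤ 1 / 2 := by
          rw [mul_one_div, div_le_div_iff₀ (by positivity) (by norm_num)]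
          linarith
  refine le_limsup_of_frequently_le (frequently_atTop.2 fun b => ?_) (by isBoundedDefault)
  obtain ⟨R, ⟨i, hi1, hi2⟩, hRb, hRc, hR0⟩ := ((h ε hε).and ((eventually_ge_atTop (2 * b)).and
    ((eventually_ge_atTop ((∑ a, (c a : ℝ)) / ε)).and (eventually_gt_atTop 0)))).exists
  rw [div_le_iff₀ hε] at hRc
  set k : α → ℕ := i + c with hk
  have hkR : ∀ a, |(k a : ℝ) - R * r a| ≤ 2 * ε * R := by
    intro a
    have h4 : (c a : ℝ) ≤ ∑ a, (c a : ℝ) :=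
      Finset.single_le_sum (f := fun a => (c a : ℝ)) (fun _ _ => by positivity)
        (Finset.mem_univ a)
    calc _ = |((i a : ℝ) - R * r a) + c a| := by
          rw [hk, Pi.add_apply, Nat.cast_add]; ring_nf
      _ ≤ |(i a : ℝ) - R * r a| + |(c a : ℝ)| := abs_add_le _ _
      _ ≤ ε * R + R * ε := by
          rw [Nat.abs_cast]
          exact add_le_add (hi1 a) (h4.trans hRc)
      _ = _ := by ring
  have hkC : (fun a => (k a : ℝ)) ∈ C := by
    have h4 : (fun a => (k a : ℝ) / R) ∈ C := by
      refine hball ((dist_pi_lt_iff hδ).2 fun a => ?_)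
      rw [Real.dist_eq]
      have h5 : (k a : ℝ) / R - r a = ((k a : ℝ) - R * r a) / R := by field_simp
      rw [h5, abs_div, abs_of_pos hR0, div_lt_iff₀ hR0]
      exact (hkR a).trans_lt (by gcongr)
    have h5 := hC.2 _ h4 R hR0
    convert h5 using 1
    ext a
    simp only [Pi.smul_apply, smul_eq_mul]
    field_simp
  set R' : ℝ := ∑ a, (k a : ℝ) with hR'
  have hRR : |R' - R| ≤ 2 * d * ε * R := by
    have h4 : R' - R = ∑ a, ((k a : ℝ) - R * r a) := by
      rw [Finset.sum_sub_distrib, ← Finset.mul_sum, hr.2, mul_one]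
    rw [h4]
    refine (Finset.abs_sum_le_sum_abs _ _).trans ((Finset.sum_le_card_nsmul _ _ _
      fun a _ => hkR a).trans_eq ?_)
    rw [Finset.card_univ, nsmul_eq_mul]
    ring
  have hRR2 : 2 * d * ε * R ≤ 1 / 2 * R := by gcongr
  obtain ⟨h5, h6⟩ := abs_le.1 hRR
  have hR'0 : 0 < R' := by linarith
  refine ⟨R', by linarith, ?_⟩
  have hGi : (0 : ℝ) < G i := (Real.exp_pos _).trans_le hi2
  have hG1 : (1 : ℝ) ≤ G i := by
    have : 0 < G i := by exact_mod_cast hGi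
    exact_mod_cast this
  have hlog : R' * s ≤ Real.log (G i) := by
    rcases le_or_gt s 0 with hs0 | hs0
    · exact (mul_nonpos_of_nonneg_of_nonpos hR'0.le hs0).trans (Real.log_nonneg hG1)
    · have h7 := (Real.le_log_iff_exp_le hGi).2 hi2
      rw [abs_of_pos hs0] at h2
      refine h7.trans' ?_
      calc R' * s ≤ (R + 2 * d * ε * R) * s := by gcongr; linarith
        _ = R * (s + ε * (2 * d * s + 1) - ε) := by ring
        _ ≤ R * (t - ε) := by gcongr; linarith
  have hshell : (γ k : ENNReal) ≤ shellSum γ C R' :=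
    ENNReal.le_tsum (f := fun i : {i : α → ℕ // (fun a => (i a : ℝ)) ∈ C ∧ R' ≤ ∑ a, (i a : ℝ) ∧
      ∑ a, (i a : ℝ) ≤ R' + 1} => (γ i.1 : ENNReal)) ⟨k, hkC, le_rfl, by linarith⟩
  have hlogshell : ((Real.log (G i) : ℝ) : EReal) ≤ ENNReal.log (shellSum γ C R') := by
    rw [← ENNReal.log_ofReal_of_pos hGi, ENNReal.ofReal_natCast]
    refine ENNReal.log_monotone (hshell.trans' ?_)
    exact_mod_cast hγ i
  calc (s : EReal) ≤ ((1 / R' * Real.log (G i) : ℝ) : EReal) := by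
        rw [EReal.coe_le_coe_iff, one_div, ← div_eq_inv_mul, le_div_iff₀ hR'0, mul_comm]
        exact hlog
    _ ≤ _ := by
        rw [EReal.coe_mul]
        exact mul_le_mul_of_nonneg_left hlogshell (by exact_mod_cast by positivity)

theorem shellSum_le {γ : (α → ℕ) → ℕ} {C : Set (α → ℝ)} {R B : ℝ} (hR : 0 ≤ R)
    (hB : ∀ i : α → ℕ, (fun a => (i a : ℝ)) ∈ C → R ≤ ∑ a, (i a : ℝ) →
      ∑ a, (i a : ℝ) ≤ R + 1 → (γ i : ℝ) ≤ B) :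
    shellSum γ C R ≤ ENNReal.ofReal ((R + 2) ^ Fintype.card α * B) := by
  classical
  set S : Set (α → ℕ) := {i | (fun a => (i a : ℝ)) ∈ C ∧ R ≤ ∑ a, (i a : ℝ) ∧
    ∑ a, (i a : ℝ) ≤ R + 1} with hS
  set T : Finset (α → ℕ) := Fintype.piFinset fun _ => Finset.range (⌊R + 1⌋₊ + 1)
  have hST : S ⊆ T := by
    intro i hi
    rw [Finset.mem_coe, Fintype.mem_piFinset]
    intro a
    rw [Finset.mem_range, Nat.lt_succ_iff, Nat.le_floor_iff (by linarith)]
    exact (Finset.single_le_sum (f := fun a => (i a : ℝ)) (fun _ _ => by positivity)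
      (Finset.mem_univ a)).trans hi.2.2
  have hcard : ((T.card : ℕ) : ℝ) ≤ (R + 2) ^ Fintype.card α := by
    rw [Fintype.card_piFinset, Finset.prod_const, Finset.card_range, Finset.card_univ]
    push_cast
    refine pow_le_pow_left₀ (by positivity) ?_ _
    linarith [Nat.floor_le (show 0 ≤ R + 1 by linarith)]
  calc shellSum γ C R ≤ ∑' _ : S, ENNReal.ofReal B := by
        refine ENNReal.tsum_le_tsum fun i => ?_
        rw [← ENNReal.ofReal_natCast]
        exact ENNReal.ofReal_le_ofReal (hB i.1 i.2.1 i.2.2.1 i.2.2.2)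
    _ ≤ ∑' _ : (T : Set (α → ℕ)), ENNReal.ofReal B :=
        ENNReal.tsum_mono_subtype (fun _ => ENNReal.ofReal B) hST
    _ = T.card * ENNReal.ofReal B := by
        rw [Finset.tsum_subtype' T fun _ => ENNReal.ofReal B, Finset.sum_const, nsmul_eq_mul]
    _ = ENNReal.ofReal (T.card * B) := by
        rw [ENNReal.ofReal_mul (by positivity), ENNReal.ofReal_natCast]
    _ ≤ _ := by
        rcases le_or_gt 0 B with hB0 | hB0
        · exact ENNReal.ofReal_le_ofReal (by gcongr)
        · rw [ENNReal.ofReal_of_nonpos (mul_nonpos_of_nonneg_of_nonpos (by positivity) hB0.le)]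
          exact zero_le

/-- Chernoff's bound: where `⟨y, i⟩ > (⟨y, r⟩ - δ) ‖i‖`, the hypothesis gives `γ i ≤ K exp (b ‖i‖)`,
and a shell has only polynomially many multi-indices. Since `b + δ = τ`, the remaining `δ` absorbs
the terms that vanish as `R → ∞`. -/
theorem exists_coneExponent_le {γ : (α → ℕ) → ℕ} {y r : α → ℝ} (hr : r ∈ stdSimplex ℝ α)
    {K μ : ℝ} (hK : 0 < K) (hμ : 0 < μ)
    (h : ∀ i : α → ℕ, γ i * Real.exp (∑ a, y a * i a) ≤ K * μ ^ (∑ a, i a)) {τ : ℝ}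
    (hτ : Real.log μ - ∑ a, y a * r a < τ) :
    ∃ C : Set (α → ℝ), (IsOpenCone C ∧ r ∈ C) ∧ coneExponent γ C ≤ τ := by
  set δ := (τ - (Real.log μ - ∑ a, y a * r a)) / 2 with hδ
  have hδ0 : 0 < δ := by rw [hδ]; linarith
  set z := ∑ a, y a * r a with hz
  set b := Real.log μ - z + δ with hb
  refine ⟨{x | (z - δ) * ∑ a, x a < ∑ a, y a * x a}, ⟨⟨?_, ?_⟩, ?_⟩, ?_⟩
  · exact isOpen_lt (by fun_prop) (by fun_prop)
  · intro x hx t ht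
    simp only [Set.mem_ofPred_eq, Pi.smul_apply, smul_eq_mul] at hx ⊢
    rw [← Finset.mul_sum]
    simp only [mul_left_comm _ t]
    rw [← Finset.mul_sum]
    gcongr
  · simp only [Set.mem_ofPred_eq, hr.2, mul_one, ← hz]
    linarith
  · set d := Fintype.card α
    have hlim : Tendsto (fun R : ℝ => d * (Real.log (R + 2) / R) + (Real.log K + |b|) / R) atTop
        (𝓝 0) := by
      have h1 := (Real.tendsto_pow_log_div_mul_add_atTop 1 (-2) 1 one_ne_zero).comp
        (tendsto_atTop_add_const_right atTop (2 : ℝ) tendsto_id)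
      have h2 : Tendsto (fun R : ℝ => Real.log (R + 2) / R) atTop (𝓝 0) := by
        refine h1.congr fun R => ?_
        simp
      have h3 := (h2.const_mul (d : ℝ)).add
        ((tendsto_const_nhds (x := Real.log K + |b|)).div_atTop tendsto_id)
      simpa using h3
    refine limsup_le_of_le (by isBoundedDefault) ?_
    filter_upwards [hlim.eventually (gt_mem_nhds hδ0), eventually_gt_atTop 0] with R hR hR0
    have hbound := shellSum_le (γ := γ) (C := {x | (z - δ) * ∑ a, x a < ∑ a, y a * x a})
      (B := K * Real.exp (R * b + |b|)) hR0.le (by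
        intro i hiC hi1 hi2
        simp only [Set.mem_ofPred_eq] at hiC
        have h1 := h i
        rw [← le_div_iff₀ (Real.exp_pos _)] at h1
        refine h1.trans ?_
        rw [mul_div_assoc]
        gcongr
        rw [div_le_iff₀ (Real.exp_pos _), ← Real.exp_add, ← Real.rpow_natCast,
          Real.rpow_def_of_pos hμ, Real.exp_le_exp, Nat.cast_sum]
        set n := ∑ a, (i a : ℝ)
        -- The sign of `b` is unknown; `|b|` pays for replacing `n ∈ [R, R + 1]` by `R`.
        have h2 : (n - R) * b ≤ |b| := by
          calc _ ≤ (n - R) * |b| := mul_le_mul_of_nonneg_left (le_abs_self b) (by linarith)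
            _ ≤ 1 * |b| := mul_le_mul_of_nonneg_right (by linarith) (abs_nonneg b)
            _ = |b| := one_mul _
        have h3 : Real.log μ * n = n * b + (z - δ) * n := by rw [hb]; ring
        linarith)
    calc ((1 / R : ℝ) : EReal) * ENNReal.log (shellSum γ _ R)
        ≤ ((1 / R : ℝ) : EReal) *
          ENNReal.log (ENNReal.ofReal ((R + 2) ^ d * (K * Real.exp (R * b + |b|)))) :=
          mul_le_mul_of_nonneg_left (ENNReal.log_monotone hbound)
            (by exact_mod_cast by positivity)
      _ = ((d * (Real.log (R + 2) / R) + (Real.log K + |b|) / R + b : ℝ) : EReal) := by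
          rw [ENNReal.log_ofReal_of_pos (by positivity), ← EReal.coe_mul, EReal.coe_eq_coe_iff,
            Real.log_mul (by positivity) (by positivity), Real.log_mul (by positivity)
            (by positivity), Real.log_exp, Real.log_pow]
          field_simp
          ring
      _ ≤ τ := by
          rw [EReal.coe_le_coe_iff]
          have : b + δ = τ := by rw [hb, hδ]; ring
          linarith

end ConeExponent

/-! ## The Parry chain and the indicatrice of growth -/

section Parry

variable {α σ : Type*} [Fintype σ] [DecidableEq σ]

theorem parryMatrix_nonneg {M : NFA α σ} {v : σ → ℝ} (hv : ∀ q, 0 < v q) (s t : σ) :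
    0 ≤ parryMatrix (adjacencyMatrix M) v s t :=
  div_nonneg (mul_nonneg (adjacencyMatrix_nonneg M s t) (hv t).le)
    (mul_nonneg (perronRoot_nonneg _) (hv s).le)

variable [Fintype α]

theorem IsErgodicAutomaton.perronRoot_adjacencyMatrix_pos [Nonempty σ] {M : NFA α σ}
    (hM : IsErgodicAutomaton M) : 0 < perronRoot (adjacencyMatrix M) :=
  (hM.hasPosPowers (adjacencyMatrix_nonneg M) fun _ _ h => adjacencyMatrix_pos M h).perronRoot_pos
    (adjacencyMatrix_nonneg M)

theorem parryMatrix_pos {M : NFA α σ} {v : σ → ℝ}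
    (hρ : 0 < perronRoot (adjacencyMatrix M)) (hv : ∀ q, 0 < v q) {s t : σ}
    (h : ∃ a, t ∈ M.step s a) : 0 < parryMatrix (adjacencyMatrix M) v s t :=
  div_pos (mul_pos (adjacencyMatrix_pos M h) (hv t)) (mul_pos hρ (hv s))

variable [DecidableEq α]

/-- The tilted matrix of the Parry chain for the empirical frequencies of the letters. -/
noncomputable def tiltedParry (M : NFA α σ) (label : σ ≃ α) (v : σ → ℝ) (y : α → ℝ) :
    Matrix σ σ ℝ :=
  tiltedMatrix (parryMatrix (adjacencyMatrix M) v) (fun q => Pi.single (label q) (1 : ℝ)) y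

theorem tiltedParry_apply (M : NFA α σ) (label : σ ≃ α) (v : σ → ℝ) (y : α → ℝ) (s t : σ) :
    tiltedParry M label v y s t =
      parryMatrix (adjacencyMatrix M) v s t * Real.exp (y (label t)) := by
  simp [tiltedParry, tiltedMatrix, Pi.single_apply]

variable {M : NFA α σ} {v : σ → ℝ}

theorem tiltedParry_nonneg (label : σ ≃ α) (hv : ∀ q, 0 < v q) (y : α → ℝ) (s t : σ) :
    0 ≤ tiltedParry M label v y s t := by
  rw [tiltedParry_apply]
  exact mul_nonneg (parryMatrix_nonneg hv s t) (Real.exp_pos _).le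

theorem tiltedParry_hasPosPowers (hM : IsErgodicAutomaton M) (label : σ ≃ α)
    (hρ : 0 < perronRoot (adjacencyMatrix M)) (hv : ∀ q, 0 < v q) (y : α → ℝ) :
    HasPosPowers (tiltedParry M label v y) :=
  hM.hasPosPowers (tiltedParry_nonneg label hv y) fun s t h => by
    rw [tiltedParry_apply]
    exact mul_pos (parryMatrix_pos hρ hv h) (Real.exp_pos _)

/-- Conjugation by `diag v` and division by `ρ`, which commute with taking powers. -/
theorem tiltedParry_pow_apply (label : σ ≃ α) (hρ : 0 < perronRoot (adjacencyMatrix M))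
    (hv : ∀ q, 0 < v q) (y : α → ℝ) (n : ℕ) (s t : σ) :
    (tiltedParry M label v y ^ n) s t =
      (weightedAdjacency M label y ^ n) s t * v t / (perronRoot (adjacencyMatrix M) ^ n * v s) := by
  induction n generalizing t with
  | zero =>
    rw [pow_zero, pow_zero, pow_zero, Matrix.one_apply]
    have := hv s
    split_ifs with h
    · subst h; field_simp
    · simp
  | succ n ih =>
    rw [pow_succ, pow_succ, Matrix.mul_apply, Matrix.mul_apply, Finset.sum_mul, Finset.sum_div]
    refine Finset.sum_congr rfl fun p _ => ?_
    rw [ih, tiltedParry_apply, weightedAdjacency, parryMatrix, Matrix.of_apply, Matrix.of_apply]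
    have := hv s
    have := hv p
    field_simp
    ring

variable {label : σ ≃ α}

theorem exists_growthCoeff_accepts_mul_exp_le
    (hlabel : ∀ (s t : σ) (a : α), t ∈ M.step s a → label t = a)
    (hρ : 0 < perronRoot (adjacencyMatrix M)) (hv : ∀ q, 0 < v q) (y : α → ℝ) {s : ℝ}
    (hs : perronRoot (tiltedParry M label v y) < s) :
    ∃ K : ℝ, 0 < K ∧ ∀ i : α → ℕ, growthCoeff M.accepts i * Real.exp (∑ a, y a * i a) ≤
      K * (perronRoot (adjacencyMatrix M) * s) ^ (∑ a, i a) := by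
  obtain ⟨C, hC, hb⟩ := exists_abs_pow_entry_le _ hs
  set ρ := perronRoot (adjacencyMatrix M)
  have hs0 : 0 < s := (perronRoot_nonneg _).trans_lt hs
  have hK : 0 ≤ ∑ p, ∑ q, C * (v p / v q) := Finset.sum_nonneg fun p _ =>
    Finset.sum_nonneg fun q _ => by have := hv p; have := hv q; positivity
  refine ⟨∑ p, ∑ q, C * (v p / v q) + 1, by linarith, fun i => ?_⟩
  set n := ∑ a, i a
  have hpq : ∀ p q, growthCoeff (M.pathLanguage p q) i * Real.exp (∑ a, y a * i a) ≤
      C * (v p / v q) * (ρ * s) ^ n := by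
    intro p q
    refine (growthCoeff_mul_exp_le hlabel y p q i).trans ?_
    have h1 := (le_abs_self _).trans (hb n p q)
    rw [tiltedParry_pow_apply label hρ hv, div_le_iff₀ (mul_pos (pow_pos hρ n) (hv p)),
      ← le_div_iff₀ (hv q)] at h1
    refine h1.trans_eq ?_
    rw [mul_pow]
    ring
  calc _ ≤ (∑ p, ∑ q, (growthCoeff (M.pathLanguage p q) i : ℝ)) *
        Real.exp (∑ a, y a * i a) := by
        gcongr
        exact_mod_cast growthCoeff_accepts_le M i
    _ = ∑ p, ∑ q, growthCoeff (M.pathLanguage p q) i * Real.exp (∑ a, y a * i a) := by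
        simp only [Finset.sum_mul]
    _ ≤ ∑ p, ∑ q, C * (v p / v q) * (ρ * s) ^ n :=
        Finset.sum_le_sum fun p _ => Finset.sum_le_sum fun q _ => hpq p q
    _ = (∑ p, ∑ q, C * (v p / v q)) * (ρ * s) ^ n := by simp only [Finset.sum_mul]
    _ ≤ _ := by gcongr; linarith

/-- The diagonal entry at `q` of the weighted powers is at most the number `(n + 1) ^ d` of count
vectors, hence subexponential. -/
theorem perronRoot_mul_perronRoot_tiltedParry_le_one (hM : IsErgodicAutomaton M)
    (hlabel : ∀ (s t : σ) (a : α), t ∈ M.step s a → label t = a)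
    (hρ : 0 < perronRoot (adjacencyMatrix M)) (hv : ∀ q, 0 < v q) (y : α → ℝ) (q : σ)
    (h : ∀ i : α → ℕ, growthCoeff (M.pathLanguage q q) i * Real.exp (∑ a, y a * i a) ≤ 1) :
    perronRoot (adjacencyMatrix M) * perronRoot (tiltedParry M label v y) ≤ 1 := by
  set ρ := perronRoot (adjacencyMatrix M)
  have hle : perronRoot (tiltedParry M label v y) ≤ ρ⁻¹ := by
    refine (tiltedParry_hasPosPowers hM label hρ hv y).perronRoot_le
      (tiltedParry_nonneg label hv y) q (Fintype.card α) zero_le_one (inv_pos.2 hρ) fun n => ?_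
    have hA : (weightedAdjacency M label y ^ n) q q ≤ (n + 1) ^ Fintype.card α := by
      refine (weightedAdjacency_pow_le_sum hlabel y q q n).trans
        ((Finset.sum_le_card_nsmul _ _ 1 fun i _ => h i).trans_eq ?_)
      rw [Fintype.card_piFinset, Finset.prod_const, Finset.card_range, Finset.card_univ]
      simp
    have hvq := (hv q).ne'
    rw [tiltedParry_pow_apply label hρ hv, mul_div_mul_right _ _ hvq, one_mul, inv_pow,
      ← div_eq_mul_inv]
    gcongr
  calc _ ≤ ρ * ρ⁻¹ := by gcongr
    _ = 1 := mul_inv_cancel₀ hρ.ne'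

theorem growthCoeff_le_card_pow (L : Language α) (i : α → ℕ) :
    growthCoeff L i ≤ Fintype.card α ^ (∑ a, i a) := by
  classical
  rw [growthCoeff_eq_card L i rfl]
  exact (Finset.card_filter_le _ _).trans_eq (by simp)

theorem mem_growthCone_pathLanguage (hM : IsErgodicAutomaton M)
    (hlabel : ∀ (s t : σ) (a : α), t ∈ M.step s a → label t = a)
    (hρ : 0 < perronRoot (adjacencyMatrix M)) (hv : ∀ q, 0 < v q) {r : α → ℝ}
    (hr : r ∈ stdSimplex ℝ α) (q : σ) {t : ℝ}
    (ht : ∀ y : α → ℝ, t ≤ Real.log (perronRoot (adjacencyMatrix M)) +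
      Real.log (perronRoot (tiltedParry M label v y)) - ∑ a, y a * r a) :
    (r, t) ∈ growthCone (growthCoeff (M.pathLanguage q q)) := by
  have : Nonempty σ := ⟨q⟩
  set G := growthCoeff (M.pathLanguage q q) with hGdef
  have hG : ∀ i j, G i * G j ≤ G (i + j) := fun i j =>
    (growthCoeff_mul_le _ _ i j).trans (growthCoeff_mono (M.pathLanguage_mul_le q q q) _)
  have h0 : 1 ≤ G 0 := one_le_growthCoeff (w := []) (by simp [NFA.mem_pathLanguage])
  have key : ∀ y : α → ℝ, (∀ i : α → ℕ, G i * Real.exp (∑ a, y a * i a) ≤ 1) →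
      t ≤ - ∑ a, y a * r a := by
    intro y hy
    have hpos := (tiltedParry_hasPosPowers hM label hρ hv y).perronRoot_pos
      (tiltedParry_nonneg label hv y)
    have h1 := Real.log_nonpos (mul_pos hρ hpos).le
      (perronRoot_mul_perronRoot_tiltedParry_le_one hM hlabel hρ hv y q hy)
    rw [Real.log_mul hρ.ne' hpos.ne'] at h1
    linarith [ht y]
  by_contra hnot
  obtain ⟨y, β, hβ, hy, hpos⟩ := exists_separating_of_notMem_growthCone hG h0 hnot
  rcases hβ.eq_or_lt with rfl | hβ
  -- The separating hyperplane is vertical: `y` constrains directions only. Subtracting `log d` from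
  -- the weights cancels the trivial bound `G i ≤ d ^ ‖i‖`, and a large multiple `m` of `y` then
  -- contradicts `key`.
  · simp only [zero_mul, add_zero] at hy hpos
    have : Nonempty α := ⟨label q⟩
    have hd : (0 : ℝ) < Fintype.card α := by exact_mod_cast Fintype.card_pos
    obtain ⟨m, hm⟩ := exists_nat_gt ((Real.log (Fintype.card α) - t) / ∑ a, y a * r a)
    rw [div_lt_iff₀ hpos] at hm
    have h1 := key (fun a => m * y a - Real.log (Fintype.card α)) fun i => by
      have h2 : ∑ a, (m * y a - Real.log (Fintype.card α)) * i a =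
          m * (∑ a, y a * i a) - Real.log (Fintype.card α) * ((∑ a, i a : ℕ) : ℝ) := by
        simp only [sub_mul, Finset.sum_sub_distrib, Finset.mul_sum, mul_assoc, Nat.cast_sum]
      rw [h2, Real.exp_sub, Real.exp_mul (Real.log _), Real.exp_log hd, Real.rpow_natCast, ← mul_div_assoc,
        div_le_one (by positivity)]
      rcases Nat.eq_zero_or_pos (G i) with h3 | h3
      · rw [h3, Nat.cast_zero, zero_mul]
        positivity
      · calc (G i : ℝ) * Real.exp (m * ∑ a, y a * i a) ≤ G i * 1 := by
              gcongr
              exact Real.exp_le_one_iff.2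
                (mul_nonpos_of_nonneg_of_nonpos (Nat.cast_nonneg m) (hy i h3))
          _ ≤ _ := by
              rw [mul_one]
              exact_mod_cast growthCoeff_le_card_pow _ i
    have h4 : ∑ a, (m * y a - Real.log (Fintype.card α)) * r a =
        m * (∑ a, y a * r a) - Real.log (Fintype.card α) := by
      simp only [sub_mul, Finset.sum_sub_distrib, mul_assoc]
      rw [← Finset.mul_sum, ← Finset.mul_sum, hr.2, mul_one]
    rw [h4] at h1
    linarith
  -- After division by `β` the separation reads `G i * exp ⟨y / β, i⟩ ≤ 1` and `t > -⟨y / β, r⟩`.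
  · have hdiv : ∀ x : α → ℝ, ∑ a, y a / β * x a = (∑ a, y a * x a) / β := fun x => by
      rw [Finset.sum_div]
      exact Finset.sum_congr rfl fun a _ => by ring
    have h1 := key (fun a => y a / β) fun i => by
      rcases Nat.eq_zero_or_pos (G i) with h3 | h3
      · rw [h3, Nat.cast_zero, zero_mul]
        exact zero_le_one
      · have h4 : (0 : ℝ) < G i := by exact_mod_cast h3
        rw [hdiv fun a => (i a : ℝ)]
        nth_rewrite 1 [← Real.exp_log h4]
        rw [← Real.exp_add, Real.exp_le_one_iff]
        have h5 := div_nonpos_of_nonpos_of_nonneg (hy i h3) hβ.le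
        rwa [add_div, mul_div_cancel_left₀ _ hβ.ne', add_comm] at h5
    rw [hdiv, ← neg_div, le_div_iff₀ hβ] at h1
    linarith

theorem markovRate_eq_log_sub_indicatrice (hstart : M.start.Nonempty) (haccept : M.accept.Nonempty)
    (hM : IsErgodicAutomaton M)
    (hlabel : ∀ (s t : σ) (a : α), t ∈ M.step s a → label t = a) (hv : ∀ q, 0 < v q)
    {r : α → ℝ} (hr : r ∈ stdSimplex ℝ α) :
    markovRate (parryMatrix (adjacencyMatrix M) v) (fun q => Pi.single (label q) (1 : ℝ)) r
        = ((Real.log (perronRoot (adjacencyMatrix M)) : ℝ) : EReal)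
            - indicatrice (growthCoeff M.accepts) r := by
  obtain ⟨q, hq⟩ := hstart
  obtain ⟨f, hf⟩ := haccept
  have : Nonempty σ := ⟨q⟩
  have hρ := hM.perronRoot_adjacencyMatrix_pos
  have hr0 : r ≠ 0 := by
    rintro rfl
    simpa using hr.2
  have hnorm : ∑ a, |r a| = 1 := by
    rw [← hr.2]
    exact Finset.sum_congr rfl fun a _ => abs_of_nonneg (hr.1 a)
  rw [indicatrice, if_neg hr0, hnorm, EReal.coe_one, one_mul]
  set ψ := ⨅ C : {C : Set (α → ℝ) // IsOpenCone C ∧ r ∈ C},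
    coneExponent (growthCoeff M.accepts) C.1 with hψ
  change (⨆ y : α → ℝ, ((∑ a, y a * r a - Real.log (perronRoot (tiltedParry M label v y)) : ℝ) :
    EReal)) = _
  refine le_antisymm (iSup_le fun y => ?_) ?_
  · have hpos := (tiltedParry_hasPosPowers hM label hρ hv y).perronRoot_pos
      (tiltedParry_nonneg label hv y)
    set l := perronRoot (tiltedParry M label v y)
    set ρ := perronRoot (adjacencyMatrix M)
    have hle : ψ ≤ ((Real.log ρ + Real.log l - ∑ a, y a * r a : ℝ) : EReal) := by
      refine EReal.le_of_forall_lt_iff_le.1 fun τ hτ => ?_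
      have hτ' : Real.log ρ + Real.log l - ∑ a, y a * r a < τ := by exact_mod_cast hτ
      have hcont : Filter.Tendsto (fun s => Real.log ρ + Real.log s - ∑ a, y a * r a)
          (nhdsWithin l (Set.Ioi l)) (nhds (Real.log ρ + Real.log l - ∑ a, y a * r a)) :=
        (((Real.continuousAt_log hpos.ne').tendsto.mono_left nhdsWithin_le_nhds).const_add
          _).sub_const _
      obtain ⟨s, hs1, hs2⟩ :=
        ((hcont.eventually (gt_mem_nhds hτ')).and self_mem_nhdsWithin).exists
      have hs0 : 0 < s := hpos.trans hs2
      obtain ⟨K, hK, hb⟩ := exists_growthCoeff_accepts_mul_exp_le hlabel hρ hv y hs2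
      obtain ⟨C, hC, hCτ⟩ := exists_coneExponent_le hr hK (mul_pos hρ hs0) hb (τ := τ)
        (by rwa [Real.log_mul hρ.ne' hs0.ne'])
      exact iInf_le_of_le ⟨C, hC⟩ hCτ
    calc ((∑ a, y a * r a - Real.log l : ℝ) : EReal)
        = (Real.log ρ : EReal) - ((Real.log ρ + Real.log l - ∑ a, y a * r a : ℝ) : EReal) := by
          rw [← EReal.coe_sub, EReal.coe_eq_coe_iff]
          ring
      _ ≤ _ := EReal.sub_le_sub le_rfl hle
  -- Testing real `c` above the rate makes the case of an infinite rate vacuous.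
  · refine EReal.le_of_forall_lt_iff_le.1 fun c hc => ?_
    have hmem := mem_growthCone_pathLanguage hM hlabel hρ hv hr q
      (t := Real.log (perronRoot (adjacencyMatrix M)) - c) fun y => by
        have h1 := (le_iSup (fun y : α → ℝ => ((∑ a, y a * r a -
          Real.log (perronRoot (tiltedParry M label v y)) : ℝ) : EReal)) y).trans hc.le
        rw [EReal.coe_le_coe_iff] at h1
        linarith
    -- Appending one fixed word turns loops at `q` into accepted words and shifts letter counts by a
    -- constant, which does not affect exponents.
    obtain ⟨w, hw⟩ := hM.exists_mem_pathLanguage q f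
    have hγ : ∀ i, growthCoeff (M.pathLanguage q q) i ≤
        growthCoeff M.accepts (i + fun a => w.count a) := fun i =>
      calc _ ≤ growthCoeff (M.pathLanguage q q) i *
            growthCoeff (M.pathLanguage q f) (fun a => w.count a) :=
            Nat.le_mul_of_pos_right _ (one_le_growthCoeff hw)
        _ ≤ _ := (growthCoeff_mul_le _ _ _ _).trans (growthCoeff_mono
            ((M.pathLanguage_mul_le q q f).trans (NFA.pathLanguage_le_accepts hq hf)) _)
    have hle : ((Real.log (perronRoot (adjacencyMatrix M)) - c : ℝ) : EReal) ≤ ψ :=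
      le_iInf fun C =>
        le_coneExponent_of_mem_growthCone (fun a => w.count a) hγ hr hmem C.2.1 C.2.2
    refine (EReal.sub_le_sub le_rfl hle).trans_eq ?_
    rw [← EReal.coe_sub, EReal.coe_eq_coe_iff]
    ring

theorem markovRate_eq_sanovRate (hM : IsErgodicAutomaton M) [Nonempty σ] (hv : ∀ q, 0 < v q)
    {r : α → ℝ} (hr : r ∈ stdSimplex ℝ α) :
    markovRate (parryMatrix (adjacencyMatrix M) v) (fun q => Pi.single (label q) (1 : ℝ)) r
        = sanovRate (parryMatrix (adjacencyMatrix M) v) (fun q => r (label q)) := by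
  have hρ := hM.perronRoot_adjacencyMatrix_pos
  set P := parryMatrix (adjacencyMatrix M) v with hP
  have hr1 : ∑ j, r (label j) = 1 := by rw [label.sum_comp, hr.2]
  have htilt : ∀ (u : σ → ℝ) (y : α → ℝ) (j : σ),
      Matrix.vecMul u (tiltedParry M label v y) j = Matrix.vecMul u P j * Real.exp (y (label j)) := by
    intro u y j
    simp only [Matrix.vecMul, dotProduct, tiltedParry_apply, Finset.sum_mul, mul_assoc, hP]
  -- Every state has an incoming edge, so the quotients in `sanovRate` are genuine and positive.
  have huP : ∀ u : σ → ℝ, (∀ j, 0 < u j) → ∀ j, 0 < Matrix.vecMul u P j := by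
    intro u hu j
    obtain ⟨i, hi⟩ : ∃ i, ∃ a, j ∈ M.step i a := by
      cases hM j j with
      | single h => exact ⟨_, h⟩
      | tail _ h => exact ⟨_, h⟩
    exact Finset.sum_pos' (fun k _ => mul_nonneg (hu k).le (parryMatrix_nonneg hv k j))
      ⟨i, Finset.mem_univ i, mul_pos (hu i) (parryMatrix_pos hρ hv hi)⟩
  change (⨆ y : α → ℝ, ((∑ a, y a * r a - Real.log (perronRoot (tiltedParry M label v y)) : ℝ) :
    EReal)) = _
  refine le_antisymm (iSup_le fun y => ?_) (iSup_le fun ⟨u, hu⟩ => ?_)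
  · have hpos := (tiltedParry_hasPosPowers hM label hρ hv y).perronRoot_pos
      (tiltedParry_nonneg label hv y)
    set l := perronRoot (tiltedParry M label v y) with hl
    refine EReal.ge_of_forall_gt_iff_ge.1 fun c hc => ?_
    have hc' : c < ∑ a, y a * r a - Real.log l := by exact_mod_cast hc
    have hcont : Filter.Tendsto (fun s => ∑ a, y a * r a - Real.log s)
        (nhdsWithin l (Set.Ioi l)) (nhds (∑ a, y a * r a - Real.log l)) :=
      ((Real.continuousAt_log hpos.ne').tendsto.mono_left nhdsWithin_le_nhds).const_sub _
    obtain ⟨s, hs1, hs2⟩ := ((hcont.eventually (lt_mem_nhds hc')).and self_mem_nhdsWithin).exists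
    have hs0 : 0 < s := hpos.trans hs2
    -- Taking logarithms in `u Π(y) ≤ s u` gives `y_j - log s ≤ log (u_j / (u P)_j)`, to be averaged
    -- against `r`.
    obtain ⟨u, hu, hus⟩ := exists_vecMul_le_of_perronRoot_lt (tiltedParry_nonneg label hv y) hs2
    refine le_iSup_of_le ⟨u, hu⟩ ?_
    rw [EReal.coe_le_coe_iff]
    refine hs1.le.trans ?_
    have h1 : ∑ a, y a * r a - Real.log s = ∑ j, r (label j) * (y (label j) - Real.log s) := by
      simp only [mul_sub, Finset.sum_sub_distrib]
      rw [← Finset.sum_mul, hr1, one_mul, ← label.sum_comp]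
      simp only [mul_comm]
    rw [h1]
    refine Finset.sum_le_sum fun j _ => mul_le_mul_of_nonneg_left ?_ (hr.1 _)
    have hp := huP u hu j
    have h2 := hus j
    rw [htilt] at h2
    have h3 := Real.log_le_log (mul_pos hp (Real.exp_pos _)) h2
    rw [Real.log_mul hp.ne' (Real.exp_pos _).ne', Real.log_exp,
      Real.log_mul hs0.ne' (hu j).ne'] at h3
    rw [Real.log_div (hu j).ne' hp.ne']
    linarith
  -- With this `y` the vector `u` is fixed by the tilted matrix, so the root is at most `1` and its
  -- logarithm only helps.
  · set y : α → ℝ := fun a =>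
      Real.log (u (label.symm a) / Matrix.vecMul u P (label.symm a)) with hy
    refine le_iSup_of_le y ?_
    have hle : perronRoot (tiltedParry M label v y) ≤ 1 := by
      refine perronRoot_le_of_vecMul_le (tiltedParry_nonneg label hv y) hu one_pos fun j => ?_
      have hp := huP u hu j
      rw [htilt, hy]
      simp only [Equiv.symm_apply_apply]
      rw [Real.exp_log (div_pos (hu j) hp), mul_div_cancel₀ _ hp.ne', one_mul]
    have hlog := Real.log_nonpos (perronRoot_nonneg _) hle
    rw [EReal.coe_le_coe_iff, ← label.sum_comp]
    simp only [hy, Equiv.symm_apply_apply]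
    simp only [hy] at hlog
    simp only [mul_comm (r _)]
    linarith

end Parry

theorem mainTheorem4 {α σ : Type*} [Fintype α] [DecidableEq α] [Fintype σ] [DecidableEq σ]
    (M : NFA α σ) (hstart : M.start.Nonempty) (haccept : M.accept.Nonempty)
    (hM : IsErgodicAutomaton M)
    (label : σ ≃ α) (hlabel : ∀ (s t : σ) (a : α), t ∈ M.step s a → label t = a)
    (v : σ → ℝ) (hv : ∀ q, 0 < v q)
    (hAv : (adjacencyMatrix M).mulVec v = perronRoot (adjacencyMatrix M) • v)
    (r : α → ℝ) (hr : r ∈ stdSimplex ℝ α) :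
    markovRate (parryMatrix (adjacencyMatrix M) v) (fun q => Pi.single (label q) (1 : ℝ)) r
        = ((Real.log (perronRoot (adjacencyMatrix M)) : ℝ) : EReal)
            - indicatrice (growthCoeff M.accepts) r ∧
      markovRate (parryMatrix (adjacencyMatrix M) v) (fun q => Pi.single (label q) (1 : ℝ)) r
        = sanovRate (parryMatrix (adjacencyMatrix M) v) (fun q => r (label q)) := by
  have : Nonempty σ := hstart.to_type
  exact ⟨markovRate_eq_log_sub_indicatrice hstart haccept hM hlabel hv hr,
    markovRate_eq_sanovRate hM hv hr⟩
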